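/- Let $H$ be a separable complex Hilbert space. A nest on $H$ is a family $\mathcal N$ of closed subspaces of $H$ that is totally ordered by inclusion, contains $\{0\}$ and $H$, and is closed under arbitrary intersections and arbitrary closed linear spans. A nest algebra on $H$ is an algebra of the form $$\operatorname{Alg}\mathcal N=\{T\in\mathcal B(H): TM\subseteq M \text{ for every } M\in\mathcal N\}$$ for some nest $\mathcal N$ on $H$. If $\mathcal A$ is a nest algebra on $H$ and $\mathcal A^*=\{T^*:T\in\mathcal A\}$, then $$\mathcal A+\mathcal A^*=\{S+T^*: S,T\in\mathcal A\}$$ is dense in $\mathcal B(H)$ in the ultraweak topology, that is, in the coarsest topology on $\mathcal B(H)$ for which all functionals $T\mapsto\sum_{n=1}^\infty\langle Tx_n,y_n\rangle$, where $(x_n)$ and $(y_n)$ are sequences in $H$ with $\sum_n\|x_n\|^2<\infty$ and $\sum_n\|y_n\|^2<\infty$, are continuous. -/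

import Mathlib

open scoped Pointwise

noncomputable section

/-- A nest on `H`: a family of closed subspaces that is totally ordered by inclusion, contains
`0` and `H`, and is complete, i.e. closed under arbitrary intersections and arbitrary closed
linear spans (the `sInf` and `sSup` of the lattice of closed subspaces). -/
structure IsNest {H : Type*} [NormedAddCommGroup H] [InnerProductSpace ℂ H]
    (N : Set (ClosedSubmodule ℂ H)) : Prop where
  isChain : IsChain (· ≤ ·) N
  bot_mem : ⊥ ∈ N
  top_mem : ⊤ ∈ N
  sInf_mem : ∀ C : Set (ClosedSubmodule ℂ H), C ⊆ N → sInf C ∈ N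
  sSup_mem : ∀ C : Set (ClosedSubmodule ℂ H), C ⊆ N → sSup C ∈ N

/-- `Alg N`: the algebra of all bounded operators leaving each member of `N` invariant. -/
def algOfSubspaces {H : Type*} [NormedAddCommGroup H] [InnerProductSpace ℂ H]
    (N : Set (ClosedSubmodule ℂ H)) : Subalgebra ℂ (H →L[ℂ] H) where
  carrier := {T | ∀ M ∈ N, ∀ x ∈ M, T x ∈ M}
  mul_mem' := fun hS hT M hM x hx => hS M hM _ (hT M hM x hx)
  add_mem' := fun hS hT M hM x hx =>
    M.toSubmodule.add_mem (hS M hM x hx) (hT M hM x hx)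
  algebraMap_mem' := fun c M _ x hx => by
    simpa [Algebra.algebraMap_eq_smul_one] using M.toSubmodule.smul_mem c hx

/-- A nest algebra is `Alg N` for some nest `N`. -/
def IsNestAlgebra {H : Type*} [NormedAddCommGroup H] [InnerProductSpace ℂ H]
    (A : Subalgebra ℂ (H →L[ℂ] H)) : Prop :=
  ∃ N : Set (ClosedSubmodule ℂ H), IsNest N ∧ A = algOfSubspaces N

/-- Square-summable sequences of vectors of `H`. -/
def SquareSummable {H : Type*} [NormedAddCommGroup H] (x : ℕ → H) : Prop :=
  Summable fun n => ‖x n‖ ^ 2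

/-- The functional `T ↦ ∑ₙ ⟪T xₙ, yₙ⟫` on bounded operators (linear in `T`; Mathlib's inner
product is linear in its second argument). -/
def ultraweakFunctional {H : Type*} [NormedAddCommGroup H] [InnerProductSpace ℂ H]
    (x y : ℕ → H) (T : H →L[ℂ] H) : ℂ :=
  ∑' n, inner ℂ (y n) (T (x n))

/-- For square-summable sequences the series defining `ultraweakFunctional` converges
absolutely. -/
theorem summable_norm_ultraweakFunctional {H : Type*} [NormedAddCommGroup H]
    [InnerProductSpace ℂ H] {x y : ℕ → H} (hx : SquareSummable x) (hy : SquareSummable y)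
    (T : H →L[ℂ] H) : Summable fun n => ‖inner ℂ (y n) (T (x n))‖ := by
  refine Summable.of_nonneg_of_le (fun _ => norm_nonneg _) (fun n => ?_)
    ((hx.add hy).mul_left ‖T‖)
  have h1 : ‖inner ℂ (y n) (T (x n))‖ ≤ ‖y n‖ * (‖T‖ * ‖x n‖) :=
    (norm_inner_le_norm _ _).trans
      (mul_le_mul_of_nonneg_left (T.le_opNorm _) (norm_nonneg _))
  have h2 : ‖y n‖ * ‖x n‖ ≤ ‖x n‖ ^ 2 + ‖y n‖ ^ 2 := by
    nlinarith [sq_nonneg (‖x n‖ - ‖y n‖), sq_nonneg ‖x n‖, sq_nonneg ‖y n‖]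
  nlinarith [mul_le_mul_of_nonneg_left h2 (norm_nonneg T)]

/-- The ultraweak (σ-weak) topology on `B(H)`: the coarsest topology for which
`T ↦ ∑ₙ ⟪T xₙ, yₙ⟫` is continuous for all square-summable sequences `(xₙ)`, `(yₙ)`. -/
@[reducible]
def ultraweakTopology (H : Type*) [NormedAddCommGroup H] [InnerProductSpace ℂ H] :
    TopologicalSpace (H →L[ℂ] H) :=
  ⨅ (x : {x : ℕ → H // SquareSummable x}) (y : {y : ℕ → H // SquareSummable y}),
    TopologicalSpace.induced (ultraweakFunctional x.1 y.1) inferInstance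

end

/-! Write `P_M` for the projection onto `M`. For `M` in the nest and any `X`, the corner `P_M X (1 -
P_M)` lies in `Alg N` and `(1 - P_M) X P_M` in its adjoint, so only diagonal blocks matter. A block
over a gap of the nest lies in `Alg N`; for a rank-one operator, a block over a short step has small
norm, as projections of the nest are strongly continuous along sups and infs. A supremum argument up
the nest (`CompressionApprox.top_rankOne`) joins such blocks; being mutually orthogonal, their
errors combine as a maximum, not a sum (`norm_add_le_of_blocks`). So rank-one operators are norm
limits of `Alg N + (Alg N)*`, and operators of finite rank are ultraweakly dense. -/

open Filter Topology ContinuousLinearMap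

section NestProjections

variable {H : Type*} [NormedAddCommGroup H] [InnerProductSpace ℂ H] [CompleteSpace H]

/-! ### Projections onto closed subspaces and their continuity along chains. -/

namespace ClosedSubmodule

/-- The orthogonal projection onto a closed subspace. -/
noncomputable def proj (M : ClosedSubmodule ℂ H) : H →L[ℂ] H :=
  haveI : CompleteSpace M.toSubmodule := inferInstanceAs (CompleteSpace M)
  M.toSubmodule.starProjection

theorem proj_apply_mem (M : ClosedSubmodule ℂ H) (x : H) : M.proj x ∈ M := by
  have : CompleteSpace M.toSubmodule := inferInstanceAs (CompleteSpace M)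
  exact M.toSubmodule.starProjection_apply_mem x

theorem proj_eq_self_iff {M : ClosedSubmodule ℂ H} {x : H} : M.proj x = x ↔ x ∈ M := by
  have : CompleteSpace M.toSubmodule := inferInstanceAs (CompleteSpace M)
  exact M.toSubmodule.starProjection_eq_self_iff

theorem norm_proj_apply_le (M : ClosedSubmodule ℂ H) (x : H) : ‖M.proj x‖ ≤ ‖x‖ := by
  have : CompleteSpace M.toSubmodule := inferInstanceAs (CompleteSpace M)
  exact M.toSubmodule.norm_starProjection_apply_le x

theorem inner_proj_left (M : ClosedSubmodule ℂ H) (x y : H) :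
    inner ℂ (M.proj x) y = inner ℂ x (M.proj y) := by
  have : CompleteSpace M.toSubmodule := inferInstanceAs (CompleteSpace M)
  exact M.toSubmodule.inner_starProjection_left_eq_right x y

theorem star_proj (M : ClosedSubmodule ℂ H) : star M.proj = M.proj := by
  refine ContinuousLinearMap.ext fun x => ext_inner_left ℂ fun y => ?_
  rw [star_eq_adjoint, adjoint_inner_right, inner_proj_left]

theorem proj_mul_of_le {M L : ClosedSubmodule ℂ H} (h : M ≤ L) : L.proj * M.proj = M.proj :=
  ContinuousLinearMap.ext fun x => proj_eq_self_iff.2 (h (M.proj_apply_mem x))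

theorem mul_proj_of_le {M L : ClosedSubmodule ℂ H} (h : M ≤ L) : M.proj * L.proj = M.proj := by
  simpa [star_proj] using congrArg star (proj_mul_of_le h)

theorem proj_top : (⊤ : ClosedSubmodule ℂ H).proj = 1 :=
  ContinuousLinearMap.ext fun _ => proj_eq_self_iff.2 mem_top

theorem proj_bot : (⊥ : ClosedSubmodule ℂ H).proj = 0 :=
  ContinuousLinearMap.ext fun x => mem_bot.1 (proj_apply_mem _ x)

theorem norm_sq_proj_add (M : ClosedSubmodule ℂ H) (x : H) :
    ‖M.proj x‖ ^ 2 + ‖x - M.proj x‖ ^ 2 = ‖x‖ ^ 2 := by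
  have h : inner ℂ (M.proj x) (x - M.proj x) = 0 := by
    rw [inner_proj_left, map_sub, proj_eq_self_iff.2 (M.proj_apply_mem x), sub_self,
      inner_zero_right]
  have := norm_add_sq_eq_norm_sq_add_norm_sq_of_inner_eq_zero _ _ h
  rw [add_sub_cancel] at this
  nlinarith

theorem norm_proj_sub_proj_apply_le {M L : ClosedSubmodule ℂ H} (h : M ≤ L) (x : H) :
    ‖(L.proj - M.proj) x‖ ≤ ‖x - M.proj x‖ := by
  have : (L.proj - M.proj) x = L.proj (x - M.proj x) := by
    rw [map_sub, proj_eq_self_iff.2 (h (M.proj_apply_mem x)), sub_apply]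
  rw [this]
  exact L.norm_proj_apply_le _

theorem norm_proj_sub_proj_le {M L : ClosedSubmodule ℂ H} (h : M ≤ L) :
    ‖L.proj - M.proj‖ ≤ 1 := by
  refine opNorm_le_bound _ zero_le_one fun x => ?_
  rw [one_mul]
  refine (norm_proj_sub_proj_apply_le h x).trans ?_
  nlinarith [M.norm_sq_proj_add x, norm_nonneg x, norm_nonneg (x - M.proj x),
    sq_nonneg ‖M.proj x‖]

/-- Orthogonal diagonal blocks: the norm of a block sum is bounded by the bound on the blocks. -/
theorem norm_add_le_of_blocks {M L : ClosedSubmodule ℂ H} (h : M ≤ L) {ε : ℝ}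
    {d e : H →L[ℂ] H} (hd : M.proj * d * M.proj = d)
    (he : (L.proj - M.proj) * e * (L.proj - M.proj) = e) (hdε : ‖d‖ ≤ ε) (heε : ‖e‖ ≤ ε) :
    ‖d + e‖ ≤ ε := by
  have hε : 0 ≤ ε := (norm_nonneg d).trans hdε
  refine opNorm_le_bound _ hε fun x => ?_
  have h1 : d x = M.proj (d (M.proj x)) := (DFunLike.congr_fun hd x).symm
  have h2 : e x = (L.proj - M.proj) (e ((L.proj - M.proj) x)) := (DFunLike.congr_fun he x).symm
  have hdM : M.proj (d x) = d x := by
    rw [proj_eq_self_iff, h1]; exact proj_apply_mem _ _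
  have heM : M.proj (e x) = 0 := by
    rw [h2, ← mul_apply_eq_comp, mul_sub, mul_proj_of_le h, mul_proj_of_le le_rfl, sub_self, zero_apply]
  have horth : inner ℂ (d x) (e x) = 0 := by
    rw [← hdM, inner_proj_left, heM, inner_zero_right]
  have hd' : d x = d (M.proj x) := by
    conv_lhs => rw [← hd]
    conv_rhs => rw [← hd]
    simp only [mul_apply_eq_comp, proj_eq_self_iff.2 (M.proj_apply_mem x)]
  have hEE : (L.proj - M.proj) * (L.proj - M.proj) = L.proj - M.proj := by
    simp [mul_sub, sub_mul, mul_proj_of_le h, proj_mul_of_le h, mul_proj_of_le le_rfl]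
  have he' : e x = e ((L.proj - M.proj) x) := by
    rw [← mul_apply_eq_comp, ← he]
    simp only [mul_assoc, hEE]
  have n1 : ‖d x‖ ≤ ε * ‖M.proj x‖ := by
    rw [hd']; exact d.le_of_opNorm_le hdε _
  have n2 : ‖e x‖ ≤ ε * ‖x - M.proj x‖ := by
    rw [he']
    exact (e.le_of_opNorm_le heε _).trans
      (mul_le_mul_of_nonneg_left (norm_proj_sub_proj_apply_le h x) hε)
  -- Pythagoras twice: the outputs are orthogonal, and `‖M.proj x‖² + ‖x - M.proj x‖² = ‖x‖²` on the
  -- input side.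
  have hsum := norm_add_sq_eq_norm_sq_add_norm_sq_of_inner_eq_zero _ _ horth
  have q1 := pow_le_pow_left₀ (norm_nonneg _) n1 2
  have q2 := pow_le_pow_left₀ (norm_nonneg _) n2 2
  refine abs_le_of_sq_le_sq' ?_ (by positivity) |>.2
  rw [add_apply, mul_pow, ← M.norm_sq_proj_add x]
  rw [mul_pow] at q1 q2
  nlinarith

/-- The union of a chain is a dense subspace of its supremum, and `M.proj y` is at least as close to
`y` as any other point of `M`. -/
theorem exists_proj_sSup_close {C : Set (ClosedSubmodule ℂ H)} (hC : IsChain (· ≤ ·) C)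
    (hne : C.Nonempty) (x : H) {ε : ℝ} (hε : 0 < ε) :
    ∃ M ∈ C, ‖((sSup C).proj - M.proj) x‖ < ε := by
  have hmem : (sSup C).proj x ∈ sSup C := proj_apply_mem _ x
  rw [mem_sSup] at hmem
  replace hmem := Metric.mem_closure_iff.1 hmem
  obtain ⟨a, ha, hax⟩ := hmem ε hε
  have := hne.to_subtype
  replace ha : a ∈ ⨆ s ∈ C, s.toSubmodule := ha
  rw [iSup_subtype', Submodule.mem_iSup_of_directed] at ha
  · obtain ⟨⟨M, hM⟩, haM⟩ := ha
    refine ⟨M, hM, lt_of_le_of_lt ?_ hax⟩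
    have hMa : M.proj a = a := proj_eq_self_iff.2 haM
    set y := (sSup C).proj x
    have hMx : M.proj x = M.proj y := by
      rw [← mul_apply_eq_comp, mul_proj_of_le (le_sSup hM)]
    rw [dist_eq_norm, sub_apply, hMx]
    have h1 := M.norm_sq_proj_add (y - a)
    have h2 : y - a - M.proj (y - a) = y - M.proj y := by rw [map_sub, hMa]; abel
    rw [h2] at h1
    refine abs_le_of_sq_le_sq' ?_ (norm_nonneg _) |>.2
    nlinarith [sq_nonneg ‖M.proj (y - a)‖]
  · intro a b
    rcases hC.total a.2 b.2 with h | h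
    · exact ⟨b, h, le_rfl⟩
    · exact ⟨a, le_rfl, h⟩

theorem proj_orthogonal (M : ClosedSubmodule ℂ H) : Mᗮ.proj = 1 - M.proj := by
  have : CompleteSpace M.toSubmodule := inferInstanceAs (CompleteSpace M)
  exact M.toSubmodule.starProjection_orthogonal'

theorem orthogonal_sInf (C : Set (ClosedSubmodule ℂ H)) :
    (sInf C)ᗮ = sSup (orthogonal '' C) := by
  have h : (sSup (orthogonal '' C))ᗮ = sInf C := by
    rw [← sInf_orthogonal, iInf_image, sInf_eq_iInf]
    simp
  rw [← h]
  simp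

/-- Orthocomplements reverse the order and reduce this to suprema. -/
theorem exists_proj_sInf_close {C : Set (ClosedSubmodule ℂ H)} (hC : IsChain (· ≤ ·) C)
    (hne : C.Nonempty) (x : H) {ε : ℝ} (hε : 0 < ε) :
    ∃ M ∈ C, ‖(M.proj - (sInf C).proj) x‖ < ε := by
  have hC' : IsChain (· ≤ ·) (orthogonal '' C) := by
    rintro _ ⟨a, ha, rfl⟩ _ ⟨b, hb, rfl⟩ -
    exact (hC.total ha hb).symm.imp (fun h => orthogonal_le h) (fun h => orthogonal_le h)
  obtain ⟨_, ⟨M, hM, rfl⟩, h⟩ := exists_proj_sSup_close hC' (hne.image _) x hε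
  refine ⟨M, hM, ?_⟩
  rwa [← orthogonal_sInf, proj_orthogonal, proj_orthogonal, sub_sub_sub_cancel_left] at h

end ClosedSubmodule

/-! ### Blocks relative to the nest. -/

open ClosedSubmodule

/-- The additive submonoid `A + A*` of a subalgebra `A` of bounded operators. -/
def addStar (A : Subalgebra ℂ (H →L[ℂ] H)) : AddSubmonoid (H →L[ℂ] H) where
  carrier := (A : Set (H →L[ℂ] H)) + star (A : Set (H →L[ℂ] H))
  zero_mem' := ⟨0, A.zero_mem, 0, by simp, by simp⟩
  add_mem' := by
    rintro _ _ ⟨a, ha, b, hb, rfl⟩ ⟨c, hc, d, hd, rfl⟩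
    refine ⟨a + c, A.add_mem ha hc, b + d, ?_, by simp only []; abel⟩
    rw [Set.mem_star, star_add]
    exact A.add_mem hb hd

theorem mem_addStar_of_mem {A : Subalgebra ℂ (H →L[ℂ] H)} {T : H →L[ℂ] H} (h : T ∈ A) :
    T ∈ addStar A :=
  ⟨T, h, 0, by simp, by simp⟩

theorem mem_addStar_of_star_mem {A : Subalgebra ℂ (H →L[ℂ] H)} {T : H →L[ℂ] H}
    (h : star T ∈ A) : T ∈ addStar A :=
  ⟨0, A.zero_mem, T, h, by simp⟩

namespace IsNest

variable {N : Set (ClosedSubmodule ℂ H)}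

/-- A member of the nest either contains `M`, hence the range, or lies in `M` and is annihilated. -/
theorem proj_mul_mul_compl_mem (hN : IsNest N) {M : ClosedSubmodule ℂ H} (hM : M ∈ N)
    (X : H →L[ℂ] H) : M.proj * X * (1 - M.proj) ∈ algOfSubspaces N := by
  intro L hL x hx
  rcases hN.isChain.total hM hL with h | h
  · exact h (proj_apply_mem _ _)
  · have : M.proj x = x := proj_eq_self_iff.2 (h hx)
    simp [this]

theorem compl_mul_mul_proj_mem_addStar (hN : IsNest N) {M : ClosedSubmodule ℂ H} (hM : M ∈ N)
    (X : H →L[ℂ] H) : (1 - M.proj) * X * M.proj ∈ addStar (algOfSubspaces N) := by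
  apply mem_addStar_of_star_mem
  have := hN.proj_mul_mul_compl_mem hM (star X)
  simpa [star_proj, mul_assoc] using this

end IsNest

/-- Compressions to a gap of the nest belong to the nest algebra. -/
theorem gap_mul_mul_gap_mem {N : Set (ClosedSubmodule ℂ H)} {M M' : ClosedSubmodule ℂ H} (hMM' : M ≤ M')
    (hgap : ∀ L ∈ N, L ≤ M ∨ M' ≤ L) (X : H →L[ℂ] H) :
    (M'.proj - M.proj) * X * (M'.proj - M.proj) ∈ algOfSubspaces N := by
  intro L hL x hx
  rcases hgap L hL with h | h
  · have h1 : M.proj x = x := proj_eq_self_iff.2 (h hx)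
    have h2 : M'.proj x = x := proj_eq_self_iff.2 (hMM' (h hx))
    simp [h1, h2]
  · exact L.toSubmodule.sub_mem (h (proj_apply_mem _ _)) (h (hMM' (proj_apply_mem _ _)))

/-- The compression of `T` to `M` is within `ε` of `Alg N + (Alg N)*`, with an error supported
on `M`. -/
def CompressionApprox (N : Set (ClosedSubmodule ℂ H)) (T : H →L[ℂ] H) (ε : ℝ)
    (M : ClosedSubmodule ℂ H) : Prop :=
  ∃ d : H →L[ℂ] H, M.proj * d * M.proj = d ∧ ‖d‖ ≤ ε ∧
    ∃ s ∈ addStar (algOfSubspaces N), M.proj * T * M.proj = s + d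

/-! ### Approximating rank-one operators by climbing the nest. -/

namespace CompressionApprox

variable {N : Set (ClosedSubmodule ℂ H)} {T : H →L[ℂ] H} {ε : ℝ} {M M' : ClosedSubmodule ℂ H}

/-- The inductive step: the off-diagonal corners cost nothing, and the errors `d`, `e` sit on
orthogonal blocks, so `ε` does not grow. -/
theorem extend (hN : IsNest N) (hM : M ∈ N) (hle : M ≤ M') (h : CompressionApprox N T ε M)
    {s e : H →L[ℂ] H} (hs : s ∈ addStar (algOfSubspaces N))
    (hse : (M'.proj - M.proj) * T * (M'.proj - M.proj) = s + e)
    (he : (M'.proj - M.proj) * e * (M'.proj - M.proj) = e) (heε : ‖e‖ ≤ ε) :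
    CompressionApprox N T ε M' := by
  obtain ⟨d, hd, hdε, r, hr, hrd⟩ := h
  have hpp : M.proj * M.proj = M.proj := mul_proj_of_le le_rfl
  have hqq : M'.proj * M'.proj = M'.proj := mul_proj_of_le le_rfl
  have hpq := mul_proj_of_le hle
  have hqp := proj_mul_of_le hle
  have hqE : M'.proj * (M'.proj - M.proj) = M'.proj - M.proj := by rw [mul_sub, hqq, hqp]
  have hEq : (M'.proj - M.proj) * M'.proj = M'.proj - M.proj := by rw [sub_mul, hqq, hpq]
  refine ⟨d + e, ?_, norm_add_le_of_blocks hle hd he hdε heε,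
    r + M.proj * (T * (M'.proj - M.proj)) * (1 - M.proj) +
      (1 - M.proj) * ((M'.proj - M.proj) * T) * M.proj + s, ?_, ?_⟩
  · have h1 : M'.proj * d * M'.proj = d := by
      rw [← hd]
      calc _ = (M'.proj * M.proj) * d * (M.proj * M'.proj) := by noncomm_ring
        _ = _ := by rw [hqp, hpq]
    have h2 : M'.proj * e * M'.proj = e := by
      rw [← he]
      calc _ = (M'.proj * (M'.proj - M.proj)) * e * ((M'.proj - M.proj) * M'.proj) := by
            simp only [mul_assoc]
        _ = _ := by rw [hqE, hEq]
    rw [mul_add, add_mul, h1, h2]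
  · refine add_mem (add_mem (add_mem hr ?_) ?_) hs
    · exact mem_addStar_of_mem (hN.proj_mul_mul_compl_mem hM _)
    · exact hN.compl_mul_mul_proj_mem_addStar hM _
  · have h1 : (M'.proj - M.proj) * (1 - M.proj) = M'.proj - M.proj := by
      rw [mul_sub, mul_one, sub_mul, hqp, hpp, sub_self, sub_zero]
    have h2 : (1 - M.proj) * (M'.proj - M.proj) = M'.proj - M.proj := by
      rw [sub_mul, one_mul, mul_sub, hpq, hpp, sub_self, sub_zero]
    rw [mul_assoc M.proj, mul_assoc T, h1, ← mul_assoc (1 - M.proj), h2]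
    calc M'.proj * T * M'.proj = M.proj * T * M.proj + M.proj * (T * (M'.proj - M.proj)) +
          (M'.proj - M.proj) * T * M.proj + (M'.proj - M.proj) * T * (M'.proj - M.proj) := by
          noncomm_ring
      _ = _ := by rw [hrd, hse]; abel

theorem extend_of_gap (hN : IsNest N) (hM : M ∈ N) (hle : M ≤ M')
    (h : CompressionApprox N T ε M) (hgap : ∀ L ∈ N, L ≤ M ∨ M' ≤ L) :
    CompressionApprox N T ε M' := by
  have hε : 0 ≤ ε := by
    obtain ⟨d, -, hd, -⟩ := h
    exact (norm_nonneg d).trans hd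
  exact h.extend hN hM hle (mem_addStar_of_mem (gap_mul_mul_gap_mem hle hgap T))
    (add_zero _).symm (by simp) (by simpa using hε)

/-- The whole new diagonal block is counted as error. -/
theorem extend_of_small {u v : H} (hN : IsNest N) (hM : M ∈ N) (hle : M ≤ M')
    (h : CompressionApprox N (InnerProductSpace.rankOne ℂ u v) ε M)
    (hu : ‖(M'.proj - M.proj) u‖ * ‖v‖ ≤ ε) :
    CompressionApprox N (InnerProductSpace.rankOne ℂ u v) ε M' := by
  have hEE : (M'.proj - M.proj) * (M'.proj - M.proj) = M'.proj - M.proj := by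
    simp [mul_sub, sub_mul, mul_proj_of_le hle, proj_mul_of_le hle, mul_proj_of_le le_rfl]
  refine h.extend hN hM hle (zero_mem _) (zero_add _).symm ?_ ?_
  · simp only [mul_assoc, hEE]
    simp only [← mul_assoc, hEE]
  · have h1 : (M'.proj - M.proj) * InnerProductSpace.rankOne ℂ u v =
        InnerProductSpace.rankOne ℂ ((M'.proj - M.proj) u) v :=
      InnerProductSpace.comp_rankOne _ _ _
    rw [h1]
    refine (norm_mul_le _ _).trans ?_
    rw [InnerProductSpace.norm_rankOne]
    exact (mul_le_of_le_one_right (by positivity) (norm_proj_sub_proj_le hle)).trans hu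

theorem top_rankOne (hN : IsNest N) (u v : H) (hε : 0 < ε) :
    CompressionApprox N (InnerProductSpace.rankOne ℂ u v) ε ⊤ := by
  set S := {M ∈ N | CompressionApprox N (InnerProductSpace.rankOne ℂ u v) ε M} with hS
  -- The `+ 1` covers `v = 0`.
  have hδ : 0 < ε / (‖v‖ + 1) := by positivity
  have small : ∀ t : ℝ, t < ε / (‖v‖ + 1) → 0 ≤ t → t * ‖v‖ ≤ ε := by
    intro t ht ht0
    rw [lt_div_iff₀ (by positivity)] at ht
    linarith
  have hbot : ⊥ ∈ S :=
    ⟨hN.bot_mem, 0, by simp, by simpa using hε.le, 0, zero_mem _, by simp [proj_bot]⟩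
  have hSN : S ⊆ N := fun _ h => h.1
  have hL : sSup S ∈ S := by
    obtain ⟨M, hM, hMu⟩ := exists_proj_sSup_close (hN.isChain.mono hSN) ⟨_, hbot⟩ u hδ
    exact ⟨hN.sSup_mem S hSN,
      hM.2.extend_of_small hN hM.1 (le_sSup hM) (small _ hMu (norm_nonneg _))⟩
  set L := sSup S
  by_contra htop
  have hLtop : L < ⊤ := lt_top_iff_ne_top.2 fun h => htop (h ▸ hL.2)
  set C := {M ∈ N | L < M}
  have hCN : C ⊆ N := fun _ h => h.1
  have hle : L ≤ sInf C := le_sInf fun M hM => hM.2.le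
  -- No member of the nest lies strictly between `L` and `sInf C`. Maximality of `L` then forces
  -- equality, so members strictly above `L` come arbitrarily close to it at `u`, and a small step
  -- passes beyond `L`.
  have hC : sInf C ∈ S := by
    refine ⟨hN.sInf_mem C hCN, hL.2.extend_of_gap hN hL.1 hle fun K hK => ?_⟩
    rcases hN.isChain.total hK hL.1 with h | h
    · exact .inl h
    · rcases h.eq_or_lt with h | h
      · exact .inl h.ge
      · exact .inr (sInf_le ⟨hK, h⟩)
  have hCL : sInf C = L := le_antisymm (le_sSup hC) hle
  obtain ⟨M, hM, hMu⟩ := exists_proj_sInf_close (hN.isChain.mono hCN) ⟨⊤, hN.top_mem, hLtop⟩ u hδ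
  rw [hCL] at hMu
  have : M ∈ S :=
    ⟨hM.1, hL.2.extend_of_small hN hL.1 hM.2.le (small _ hMu (norm_nonneg _))⟩
  exact (le_sSup this).not_gt hM.2

end CompressionApprox

/-- Rank-one operators are norm limits of elements of `Alg N + (Alg N)*`. -/
theorem IsNest.rankOne_mem_topologicalClosure {N : Set (ClosedSubmodule ℂ H)} (hN : IsNest N)
    (u v : H) :
    InnerProductSpace.rankOne ℂ u v ∈ (addStar (algOfSubspaces N)).topologicalClosure := by
  refine Metric.mem_closure_iff.2 ?_
  intro ε hε
  obtain ⟨d, -, hd, s, hs, hsd⟩ := CompressionApprox.top_rankOne hN u v (half_pos hε)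
  refine ⟨s, hs, ?_⟩
  rw [proj_top, one_mul, mul_one] at hsd
  rw [hsd, dist_eq_norm, add_sub_cancel_left]
  linarith

theorem IsNest.starProjection_mul_mem_topologicalClosure {N : Set (ClosedSubmodule ℂ H)}
    (hN : IsNest N) (U : Submodule ℂ H) [FiniteDimensional ℂ U] (T : H →L[ℂ] H) :
    U.starProjection * T ∈ (addStar (algOfSubspaces N)).topologicalClosure := by
  rw [(stdOrthonormalBasis ℂ U).starProjection_eq_sum_rankOne, Finset.sum_mul]
  refine sum_mem fun i _ => ?_
  convert hN.rankOne_mem_topologicalClosure (stdOrthonormalBasis ℂ U i : H)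
    (adjoint T (stdOrthonormalBasis ℂ U i : H)) using 1
  ext x
  simp [adjoint_inner_left]

end NestProjections

/-! ### Ultraweak convergence. -/

section Ultraweak

variable {H : Type*} [NormedAddCommGroup H] [InnerProductSpace ℂ H]

theorem tendsto_ultraweak_iff {α : Type*} {l : Filter α} {f : α → H →L[ℂ] H} {T : H →L[ℂ] H} :
    Tendsto f l (@nhds _ (ultraweakTopology H) T) ↔
      ∀ x y : ℕ → H, SquareSummable x → SquareSummable y →
        Tendsto (fun a => ultraweakFunctional x y (f a)) l (𝓝 (ultraweakFunctional x y T)) := by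
  simp only [nhds_iInf, nhds_induced, tendsto_iInf, tendsto_comap_iff, Subtype.forall,
    Function.comp_def]
  exact ⟨fun h x y hx hy => h x hx y hy, fun h x hx y hy => h x y hx hy⟩

/-- A bounded family converging pointwise converges ultraweakly. -/
theorem tendsto_ultraweak_of_tendsto_apply {α : Type*} {l : Filter α} {f : α → H →L[ℂ] H}
    {T : H →L[ℂ] H} {K : ℝ} (hK : ∀ᶠ a in l, ‖f a‖ ≤ K)
    (h : ∀ x, Tendsto (fun a => f a x) l (𝓝 (T x))) :
    Tendsto f l (@nhds _ (ultraweakTopology H) T) := by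
  rw [tendsto_ultraweak_iff]
  intro x y hx hy
  refine tendsto_tsum_of_dominated_convergence ((hx.add hy).mul_left K)
    (fun n => tendsto_const_nhds.inner (h (x n))) ?_
  filter_upwards [hK] with a ha n
  have hK0 : 0 ≤ K := (norm_nonneg _).trans ha
  have h1 : ‖inner ℂ (y n) (f a (x n))‖ ≤ ‖y n‖ * (K * ‖x n‖) :=
    (norm_inner_le_norm _ _).trans
      (mul_le_mul_of_nonneg_left ((f a).le_of_opNorm_le ha _) (norm_nonneg _))
  have h2 : ‖y n‖ * ‖x n‖ ≤ ‖x n‖ ^ 2 + ‖y n‖ ^ 2 := by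
    nlinarith [sq_nonneg (‖x n‖ - ‖y n‖), sq_nonneg ‖x n‖, sq_nonneg ‖y n‖]
  nlinarith [mul_le_mul_of_nonneg_left h2 hK0]

/-- The norm closure is contained in the ultraweak closure. -/
theorem closure_subset_ultraweak_closure (D : Set (H →L[ℂ] H)) :
    closure D ⊆ @closure _ (ultraweakTopology H) D := by
  intro T hT
  obtain ⟨s, hs, hlim⟩ := mem_closure_iff_seq_limit.1 hT
  obtain ⟨K, hK⟩ := (Metric.isBounded_range_of_tendsto s hlim).exists_norm_le
  refine @mem_closure_of_tendsto _ (ultraweakTopology H) _ _ _ _ _ _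
    (tendsto_ultraweak_of_tendsto_apply (K := K) (Eventually.of_forall fun n => hK _ ⟨n, rfl⟩)
      fun x => ((ContinuousLinearMap.apply ℂ H x).continuous.tendsto T).comp hlim)
    (Eventually.of_forall hs)

theorem tendsto_ultraweak_starProjection_mul [CompleteSpace H] (T : H →L[ℂ] H) :
    Tendsto (fun U : {U : Submodule ℂ H // FiniteDimensional ℂ U} =>
      haveI := U.2
      U.1.starProjection * T) atTop (@nhds _ (ultraweakTopology H) T) := by
  have (U : {U : Submodule ℂ H // FiniteDimensional ℂ U}) : FiniteDimensional ℂ U.1 := U.2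
  refine tendsto_ultraweak_of_tendsto_apply (K := ‖T‖) (Eventually.of_forall fun U => ?_)
    fun x => ?_
  · exact (norm_mul_le _ _).trans
      (mul_le_of_le_one_left (norm_nonneg _) U.1.starProjection_norm_le)
  · refine Submodule.starProjection_tendsto_self
      (fun U : {U : Submodule ℂ H // FiniteDimensional ℂ U} => U.1) (fun _ _ h => h) (T x) ?_
    intro y _
    refine Submodule.le_topologicalClosure _ ?_
    exact Submodule.mem_iSup_of_mem
      (⟨ℂ ∙ y, inferInstance⟩ : {U : Submodule ℂ H // FiniteDimensional ℂ U})
      (Submodule.mem_span_singleton_self y)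

end Ultraweak

theorem corollary3p10 {H : Type*} [NormedAddCommGroup H] [InnerProductSpace ℂ H]
    [CompleteSpace H] [TopologicalSpace.SeparableSpace H]
    (A : Subalgebra ℂ (H →L[ℂ] H)) (hA : IsNestAlgebra A) :
    @Dense (H →L[ℂ] H) (ultraweakTopology H)
      ((A : Set (H →L[ℂ] H)) + star (A : Set (H →L[ℂ] H))) := by
  obtain ⟨N, hN, rfl⟩ := hA
  intro T
  -- `T` is a limit of the net `U.starProjection * T`, whose terms are themselves only in the
  -- closure.
  rw [← @closure_closure _ (ultraweakTopology H)]
  have : Nonempty {U : Submodule ℂ H // FiniteDimensional ℂ U} := ⟨⟨⊥, inferInstance⟩⟩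
  have : IsDirectedOrder {U : Submodule ℂ H // FiniteDimensional ℂ U} :=
    ⟨fun U V => by
      have := U.2
      have := V.2
      exact ⟨⟨U.1 ⊔ V.1, inferInstance⟩, (le_sup_left : U.1 ≤ _), (le_sup_right : V.1 ≤ _)⟩⟩
  refine @mem_closure_of_tendsto _ (ultraweakTopology H) _ _ _ _ _ _
    (tendsto_ultraweak_starProjection_mul T) (Eventually.of_forall fun U => ?_)
  have := U.2
  exact closure_subset_ultraweak_closure _ (hN.starProjection_mul_mem_topologicalClosure U.1 T)
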